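/- Let $M>0$ and $a\in\mathbb R$ with $a^2\le M^2$, and let $r_1=M+\sqrt{M^2-a^2}$. Put $$\Delta(r)=r^2-2Mr+a^2,\qquad U(r,\vartheta)=r^2+a^2\cos^2\vartheta,\qquad \sigma^2(r,\vartheta)=(r^2+a^2)\,U+2Mr\,a^2\sin^2\vartheta .$$ Let $\Sigma=(r_1,\infty)\times S^2$ be the region outside the event horizon, identified through polar coordinates $x=r(\sin\vartheta\cos\varphi,\sin\vartheta\sin\varphi,\cos\vartheta)$ with the open set $\{x\in\mathbb R^3:\|x\|>r_1\}$. Then the tensor $$\hat{\mathbf g}=\frac{\sigma^2}{\Delta^2}\,dr^2+\frac{\sigma^2}{\Delta}\big(d\vartheta^2+\sin^2\vartheta\,d\varphi^2\big)$$ is a smooth Riemannian metric on $\Sigma$ (including the axis $\sin\vartheta=0$). Explicitly, with $r=\|x\|$ and $\cos\vartheta=x_3/r$, its Cartesian components are $$\hat g_{ij}(x)=\frac{\sigma^2}{\Delta^2}\,\frac{x_ix_j}{r^2}+\frac{\sigma^2}{\Delta}\,\frac1{r^2}\Big(\delta_{ij}-\frac{x_ix_j}{r^2}\Big),$$ and the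 pull-back of this tensor under the polar coordinate map is the expression above for all $r>r_1$ and all $\vartheta,\varphi$. Moreover, the Riemannian manifold $(\Sigma,\hat{\mathbf g})$ is geodesically complete: for every $p\in\Sigma$ and every tangent vector $v\in T_p\Sigma$ there is a geodesic $\gamma:\mathbb R\to\Sigma$ of $\hat{\mathbf g}$, defined for all times, with $\gamma(0)=p$ and $\gamma'(0)=v$. -/

import Mathlib

open scoped ContDiff

noncomputable section

/-! ### Riemannian metrics on an open subset of `ℝⁿ` and their geodesics -/

/-- The partial derivative `∂ᵢ f` at `x`. -/
def partialDeriv {n : ℕ} (i : Fin n) (f : EuclideanSpace ℝ (Fin n) → ℝ)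
    (x : EuclideanSpace ℝ (Fin n)) : ℝ :=
  fderiv ℝ f x (EuclideanSpace.single i 1)

/-- The matrix field `g = (g_ij)` is a smooth Riemannian metric on the set `S`
(used for open `S`): smooth components, symmetric and positive definite at every point. -/
def IsRiemannianMetricOn {n : ℕ}
    (g : EuclideanSpace ℝ (Fin n) → Matrix (Fin n) (Fin n) ℝ)
    (S : Set (EuclideanSpace ℝ (Fin n))) : Prop :=
  (∀ i j, ContDiffOn ℝ ∞ (fun x => g x i j) S) ∧ ∀ x ∈ S, (g x).PosDef

/-- The Christoffel symbols of the Levi-Civita connection,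
`Γᵏᵢⱼ = ½ ∑ₗ gᵏˡ (∂ᵢ g_jl + ∂ⱼ g_il - ∂ₗ g_ij)`. -/
def christoffel {n : ℕ} (g : EuclideanSpace ℝ (Fin n) → Matrix (Fin n) (Fin n) ℝ)
    (x : EuclideanSpace ℝ (Fin n)) (k i j : Fin n) : ℝ :=
  (1 / 2 : ℝ) * ∑ l, (g x)⁻¹ k l *
    (partialDeriv i (fun y => g y j l) x + partialDeriv j (fun y => g y i l) x
      - partialDeriv l (fun y => g y i j) x)

/-- `γ : ℝ → S` is a (smooth, affinely parametrized) geodesic of `(S, g)` defined for all times: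
`(γᵏ)'' + ∑ᵢⱼ Γᵏᵢⱼ(γ) (γⁱ)' (γʲ)' = 0`. -/
def IsCompleteGeodesic {n : ℕ} (g : EuclideanSpace ℝ (Fin n) → Matrix (Fin n) (Fin n) ℝ)
    (S : Set (EuclideanSpace ℝ (Fin n))) (γ : ℝ → EuclideanSpace ℝ (Fin n)) : Prop :=
  ContDiff ℝ ∞ γ ∧ (∀ t, γ t ∈ S) ∧
    ∀ t k, deriv (deriv γ) t k
      + ∑ i, ∑ j, christoffel g (γ t) k i j * deriv γ t i * deriv γ t j = 0

/-- Geodesic completeness: for every point `p` of `S` and every tangent vector `v` at `p`, the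
geodesic with initial data `(p, v)` exists for all times `t ∈ ℝ` (and stays in `S`). -/
def IsGeodesicallyComplete {n : ℕ} (g : EuclideanSpace ℝ (Fin n) → Matrix (Fin n) (Fin n) ℝ)
    (S : Set (EuclideanSpace ℝ (Fin n))) : Prop :=
  ∀ p ∈ S, ∀ v : EuclideanSpace ℝ (Fin n),
    ∃ γ : ℝ → EuclideanSpace ℝ (Fin n), IsCompleteGeodesic g S γ ∧ γ 0 = p ∧ deriv γ 0 = v

/-- The pull-back `F^* g` of a metric under a map `F`, in coordinates:
`(F^* g)_ij = ∑ₖₗ ∂ᵢFᵏ ∂ⱼFˡ g_kl ∘ F`. -/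
def pullbackMetric {n : ℕ} (F : EuclideanSpace ℝ (Fin n) → EuclideanSpace ℝ (Fin n))
    (g : EuclideanSpace ℝ (Fin n) → Matrix (Fin n) (Fin n) ℝ)
    (q : EuclideanSpace ℝ (Fin n)) : Matrix (Fin n) (Fin n) ℝ :=
  Matrix.of fun i j => ∑ k, ∑ l,
    partialDeriv i (fun y => F y k) q * partialDeriv j (fun y => F y l) q * g (F q) k l

/-! ### The Kerr exterior -/

/-- `Δ(r) = r² - 2 M r + a²`. -/
def kerrDelta (M a r : ℝ) : ℝ := r ^ 2 - 2 * M * r + a ^ 2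

/-- `U(r, ϑ) = r² + a² cos² ϑ`. -/
def kerrU (a r ϑ : ℝ) : ℝ := r ^ 2 + a ^ 2 * Real.cos ϑ ^ 2

/-- `σ²(r, ϑ) = (r² + a²) U + 2 M r a² sin² ϑ`. -/
def kerrSigmaSq (M a r ϑ : ℝ) : ℝ :=
  (r ^ 2 + a ^ 2) * kerrU a r ϑ + 2 * M * r * a ^ 2 * Real.sin ϑ ^ 2

/-- The radius `r₁ = M + √(M² - a²)` of the event horizon. -/
def kerrHorizon (M a : ℝ) : ℝ := M + √(M ^ 2 - a ^ 2)

/-- The spatial manifold `Σ ≅ (r₁, ∞) × S²` outside the event horizon, with `(r, ω)` represented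
by the point `x = r ω` of `ℝ³`. -/
def kerrExterior (M a : ℝ) : Set (EuclideanSpace ℝ (Fin 3)) := {x | kerrHorizon M a < ‖x‖}

/-- The polar coordinates `(r, ϑ, φ) ↦ r (sin ϑ cos φ, sin ϑ sin φ, cos ϑ)`. -/
def polarMap (q : EuclideanSpace ℝ (Fin 3)) : EuclideanSpace ℝ (Fin 3) :=
  !₂[q 0 * (Real.sin (q 1) * Real.cos (q 2)), q 0 * (Real.sin (q 1) * Real.sin (q 2)),
    q 0 * Real.cos (q 1)]

/-- The metric `ĝ = σ²/Δ² dr² + σ²/Δ (dϑ² + sin² ϑ dφ²)` on the exterior region, as a tensor field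
on `{x ∈ ℝ³ : ‖x‖ > r₁}`, where `r = ‖x‖`, `cos ϑ = x₃/r`,
`dr² = ∑ᵢⱼ (xᵢ xⱼ / r²) dxᵢ dxⱼ`, and where the metric of the unit sphere is
`dϑ² + sin² ϑ dφ² = ∑ᵢⱼ r⁻² (δᵢⱼ - xᵢ xⱼ / r²) dxᵢ dxⱼ`. -/
def kerrHatMetric (M a : ℝ) (x : EuclideanSpace ℝ (Fin 3)) : Matrix (Fin 3) (Fin 3) ℝ :=
  let r := ‖x‖
  let ϑ := Real.arccos (x 2 / r)
  Matrix.of fun i j =>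
    kerrSigmaSq M a r ϑ / kerrDelta M a r ^ 2 * (x i * x j / r ^ 2)
      + kerrSigmaSq M a r ϑ / kerrDelta M a r
        * (((if i = j then 1 else 0) - x i * x j / r ^ 2) / r ^ 2)

end

/-! Completeness holds because the horizon and infinity are both infinitely far away. On the
exterior σ² ≥ r⁴ and Δ ≤ r², so the radial coefficient σ²/Δ² and the tangential one σ²/(Δ r²) are at
least 1 and ĝ dominates the Euclidean metric. Moreover |dr(v)| ≤ (Δ/r²) √ĝ(v,v), and Δ ≤ (r - r₁) r;
hence f = log(r - r₁) has ĝ-gradient at most 1/r₁, while the sets |f| ≤ R are compact shells in Σ.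

Geodesics conserve ĝ(γ', γ'). Domination therefore bounds the velocity, and the gradient bound makes
f change at most linearly in time. Over finite time the geodesic flow stays in a compact subset of
the tangent bundle (`IsRiemannianMetricOn.isGeodesicallyComplete`).

The passage from such bounds to global existence (`exists_global_integralCurve`) avoids maximal
solutions: the field X is cut off to a bounded Lipschitz field χX, which can be integrated over any
finite time. The a priori bounds also hold for χX, because χ only slows the motion along the flow;
the curve thus stays where χ = 1 and solves the original equation.

Smoothness across the axis holds because σ² depends on ϑ only through cos² ϑ = (x₃/r)². -/

/-! ### Global integral curves from a priori bounds. -/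

section GlobalExistence

variable {E : Type*} [NormedAddCommGroup E] [NormedSpace ℝ E]

/-- A bounded Lipschitz vector field has integral curves on arbitrarily long time intervals. -/
theorem exists_integralCurve_of_lipschitz_of_bounded [CompleteSpace E] {Y : E → E} {K L : NNReal}
    (hY : LipschitzWith K Y) (hL : ∀ x, ‖Y x‖ ≤ L) (z₀ : E) {T : ℝ} (hT : 0 < T) :
    ∃ z : ℝ → E, z 0 = z₀ ∧ ∀ t ∈ Set.Ioo (-T) T, HasDerivAt z (Y (z t)) t := by
  have h0 : (0 : ℝ) ∈ Set.Icc (-T) T := ⟨by linarith, hT.le⟩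
  -- With speed at most L, the curve stays within distance L T of z₀ during time T, which is the
  -- radius needed here.
  have hP : IsPicardLindelof (fun _ => Y) (⟨0, h0⟩ : Set.Icc (-T) T) z₀
      (L * T.toNNReal) 0 L K :=
    IsPicardLindelof.of_time_independent (fun x _ => hL x) hY.lipschitzOnWith (by simp [hT.le])
  obtain ⟨z, hz0, hz⟩ := hP.exists_eq_forall_mem_Icc_hasDerivWithinAt₀
  exact ⟨z, hz0, fun t ht => (hz t (Set.Ioo_subset_Icc_self ht)).hasDerivAt
    (Icc_mem_nhds ht.1 ht.2)⟩

/-- A `C¹` vector field on an open set can be cut off outside of a compact set. -/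
theorem exists_cutoff_vectorField [FiniteDimensional ℝ E] {Ω K : Set E} (hΩ : IsOpen Ω)
    (hK : IsCompact K) (hKΩ : K ⊆ Ω) {X : E → E} (hX : ContDiffOn ℝ 1 X Ω) :
    ∃ χ : E → ℝ, (∀ x, χ x ∈ Set.Icc (0 : ℝ) 1) ∧ (∀ x ∈ K, χ x = 1) ∧ (∀ x ∉ Ω, χ x = 0) ∧
      ∃ C L : NNReal, LipschitzWith C (fun x => χ x • X x) ∧ ∀ x, ‖χ x • X x‖ ≤ L := by
  obtain ⟨K', hK', hKK', hK'Ω⟩ := exists_compact_between hK hΩ hKΩ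
  obtain ⟨f, hf1, hf0, hf⟩ := exists_contMDiffMap_one_nhds_of_subset_interior
    (n := 1) (modelWithCornersSelf ℝ E) hK.isClosed hKK'
  have hfs : tsupport (f : E → ℝ) ⊆ K' :=
    closure_minimal (fun x hx => by_contra fun h => hx (hf0 x h)) hK'.isClosed
  have hfc : ContDiff ℝ 1 (f : E → ℝ) := f.contMDiff.contDiff
  have hYs : tsupport (fun x => f x • X x) ⊆ K' :=
    (tsupport_smul_subset_left (f : E → ℝ) X).trans hfs
  have hYc : HasCompactSupport (fun x => f x • X x) :=
    hK'.of_isClosed_subset (isClosed_tsupport _) hYs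
  have hY : ContDiff ℝ 1 (fun x => f x • X x) := by
    rw [contDiff_iff_contDiffAt]
    intro x
    by_cases hx : x ∈ Ω
    · exact hfc.contDiffAt.smul (hX.contDiffAt (hΩ.mem_nhds hx))
    -- X is uncontrolled outside Ω, but the product vanishes near x because its support lies in K' ⊆
    -- Ω.
    · have : (fun x => f x • X x) =ᶠ[nhds x] fun _ => 0 := by
        have : x ∉ tsupport (fun x => f x • X x) := fun h => hx (hK'Ω (hYs h))
        exact notMem_tsupport_iff_eventuallyEq.mp this
      exact contDiffAt_const.congr_of_eventuallyEq this
  obtain ⟨C, hC⟩ := hY.lipschitzWith_of_hasCompactSupport hYc one_ne_zero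
  obtain ⟨L, hL⟩ := hYc.exists_bound_of_continuous hY.continuous
  exact ⟨f, hf, fun x hx => hf1.self_of_nhdsSet x hx, fun x hx => hf0 x fun h => hx (hK'Ω h), C,
    L.toNNReal, hC, fun x => (hL x).trans (Real.le_coe_toNNReal L)⟩

/-- If the integral curves through `z₀` of all rescalings `χ • X` with `0 ≤ χ ≤ 1` obey a priori
bounds confining them to a compact set in finite time, then the integral curve of `X` through `z₀`
is defined for all times. -/
theorem exists_global_integralCurve [FiniteDimensional ℝ E] {Ω : Set E} (hΩ : IsOpen Ω)
    {X : E → E} (hX : ContDiffOn ℝ 1 X Ω) {z₀ : E} (hz₀ : z₀ ∈ Ω)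
    (H : ∀ T > 0, ∃ K ⊆ Ω, IsCompact K ∧ ∀ χ : E → ℝ, (∀ x, χ x ∈ Set.Icc (0 : ℝ) 1) →
      ∀ z : ℝ → E, z 0 = z₀ →
        (∀ t ∈ Set.Ioo (-T) T, z t ∈ Ω ∧ HasDerivAt z (χ (z t) • X (z t)) t) →
        ∀ t ∈ Set.Ioo (-T) T, z t ∈ K) :
    ∃ z : ℝ → E, z 0 = z₀ ∧ ∀ t, z t ∈ Ω ∧ HasDerivAt z (X (z t)) t := by
  have := FiniteDimensional.complete ℝ E
  have zero_mem : ∀ {T : ℝ}, 0 < T → (0 : ℝ) ∈ Set.Ioo (-T) T := fun h => ⟨by linarith, h⟩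
  have local_sol : ∀ T > 0, ∃ z : ℝ → E, z 0 = z₀ ∧
      ∀ t ∈ Set.Ioo (-T) T, z t ∈ Ω ∧ HasDerivAt z (X (z t)) t := by
    intro T hT
    obtain ⟨K, hKΩ, hK, hKz⟩ := H T hT
    obtain ⟨χ, hχ, hχ1, hχ0, C, L, hC, hL⟩ := exists_cutoff_vectorField hΩ hK hKΩ hX
    obtain ⟨z, hz0, hz⟩ := exists_integralCurve_of_lipschitz_of_bounded hC hL z₀ hT
    have hzΩ : ∀ t ∈ Set.Ioo (-T) T, z t ∈ Ω := by
      intro t ht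
      by_contra hn
      -- Points outside Ω are stationary for χX, so a curve reaching one would be constant by
      -- uniqueness, contradicting z₀ ∈ Ω.
      have heq := ODE_solution_unique_of_mem_Ioo (v := fun _ x => χ x • X x)
        (s := fun _ => Set.univ) (f := z) (g := fun _ => z t)
        (fun _ _ => hC.lipschitzOnWith) ht (fun s hs => ⟨hz s hs, trivial⟩)
        (fun s _ => ⟨by simpa [hχ0 _ hn] using hasDerivAt_const s (z t), trivial⟩) rfl
        (zero_mem hT)
      exact hn (by rw [← show z 0 = z t from heq, hz0]; exact hz₀)
    have hzK := hKz χ hχ z hz0 fun t ht => ⟨hzΩ t ht, hz t ht⟩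
    refine ⟨z, hz0, fun t ht => ⟨hzΩ t ht, ?_⟩⟩
    simpa [hχ1 _ (hzK t ht)] using hz t ht
  have unique : ∀ T > 0, ∀ z w : ℝ → E, z 0 = z₀ → w 0 = z₀ →
      (∀ t ∈ Set.Ioo (-T) T, z t ∈ Ω ∧ HasDerivAt z (X (z t)) t) →
      (∀ t ∈ Set.Ioo (-T) T, w t ∈ Ω ∧ HasDerivAt w (X (w t)) t) →
      Set.EqOn z w (Set.Ioo (-T) T) := by
    intro T hT z w hz0 hw0 hz hw
    obtain ⟨K, hKΩ, hK, hKz⟩ := H T hT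
    obtain ⟨χ, -, hχ1, -, C, L, hC, -⟩ := exists_cutoff_vectorField hΩ hK hKΩ hX
    have key : ∀ y : ℝ → E, y 0 = z₀ →
        (∀ t ∈ Set.Ioo (-T) T, y t ∈ Ω ∧ HasDerivAt y (X (y t)) t) →
        ∀ t ∈ Set.Ioo (-T) T, HasDerivAt y (χ (y t) • X (y t)) t ∧ y t ∈ Set.univ := by
      intro y hy0 hy t ht
      -- The bound with χ = 1 confines any solution of the original equation to K, where it also
      -- solves the Lipschitz cut-off equation; uniqueness follows.
      have hyK := hKz (fun _ => 1) (fun _ => ⟨zero_le_one, le_rfl⟩) y hy0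
        (fun t ht => by simpa using hy t ht) t ht
      exact ⟨by simpa [hχ1 _ hyK] using (hy t ht).2, trivial⟩
    exact ODE_solution_unique_of_mem_Ioo (v := fun _ x => χ x • X x) (s := fun _ => Set.univ)
      (fun _ _ => hC.lipschitzOnWith) (zero_mem hT) (key z hz0 hz) (key w hw0 hw)
      (hz0.trans hw0.symm)
  choose! Z hZ0 hZ using local_sol
  have pos : ∀ t : ℝ, 0 < |t| + 1 := fun t => by positivity
  -- The glued curve uses a time interval depending on t; agreement with one fixed solution near
  -- each t makes it differentiable.
  have glue : ∀ T > 0, Set.EqOn (fun t => Z (|t| + 1) t) (Z T) (Set.Ioo (-T) T) := by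
    intro T hT t ht
    have hmin : 0 < min T (|t| + 1) := lt_min hT (pos t)
    have hsub : ∀ {S s : ℝ}, min T (|t| + 1) ≤ S →
        s ∈ Set.Ioo (-min T (|t| + 1)) (min T (|t| + 1)) → s ∈ Set.Ioo (-S) S :=
      fun h hs => ⟨by linarith [hs.1], by linarith [hs.2]⟩
    refine unique _ hmin _ _ (hZ0 _ (pos t)) (hZ0 _ hT)
      (fun s hs => hZ _ (pos t) s (hsub (min_le_right _ _) hs))
      (fun s hs => hZ _ hT s (hsub (min_le_left _ _) hs)) ?_
    rw [Set.mem_Ioo, ← abs_lt]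
    exact lt_min (abs_lt.mpr ht) (lt_add_one _)
  refine ⟨fun t => Z (|t| + 1) t, hZ0 _ (pos 0), fun t => ?_⟩
  have ht : t ∈ Set.Ioo (-(|t| + 1)) (|t| + 1) := abs_lt.mp (lt_add_one _)
  obtain ⟨h1, h2⟩ := hZ _ (pos t) t ht
  exact ⟨h1, h2.congr_of_eventuallyEq
    ((glue _ (pos t)).eventuallyEq_of_mem (Ioo_mem_nhds ht.1 ht.2))⟩

/-- Integral curves of smooth vector fields are smooth. -/
theorem contDiff_of_integralCurve {Ω : Set E} {X : E → E}
    (hX : ContDiffOn ℝ ∞ X Ω) {z : ℝ → E} (hz : ∀ t, z t ∈ Ω ∧ HasDerivAt z (X (z t)) t) :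
    ContDiff ℝ ∞ z := by
  rw [contDiff_infty]
  intro n
  have hd : deriv z = fun t => X (z t) := funext fun t => (hz t).2.deriv
  have hdiff : Differentiable ℝ z := fun t => (hz t).2.differentiableAt
  induction n with
  | zero => exact contDiff_zero.mpr hdiff.continuous
  | succ n ih =>
    rw [Nat.cast_add, Nat.cast_one, contDiff_succ_iff_deriv]
    refine ⟨hdiff, by simp, ?_⟩
    rw [hd]
    exact ((contDiffOn_infty.mp hX) n).comp_contDiff ih fun t => (hz t).1

end GlobalExistence

/-! ### Geodesic flow, conservation of energy and a completeness criterion. -/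

section Geodesics

variable {n : ℕ}

/-- The geodesic vector field on the tangent bundle. -/
noncomputable def geodesicField (g : EuclideanSpace ℝ (Fin n) → Matrix (Fin n) (Fin n) ℝ)
    (z : EuclideanSpace ℝ (Fin n) × EuclideanSpace ℝ (Fin n)) :
    EuclideanSpace ℝ (Fin n) × EuclideanSpace ℝ (Fin n) :=
  (z.2, WithLp.toLp 2 fun k => -∑ i, ∑ j, christoffel g z.1 k i j * z.2 i * z.2 j)

/-- The quadratic form `g(v, v)` as a function on the tangent bundle. -/
def metricEnergy (g : EuclideanSpace ℝ (Fin n) → Matrix (Fin n) (Fin n) ℝ)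
    (z : EuclideanSpace ℝ (Fin n) × EuclideanSpace ℝ (Fin n)) : ℝ :=
  ∑ i, ∑ j, g z.1 i j * z.2 i * z.2 j

theorem fderiv_apply_eq_sum_partialDeriv (f : EuclideanSpace ℝ (Fin n) → ℝ)
    (x v : EuclideanSpace ℝ (Fin n)) :
    fderiv ℝ f x v = ∑ k, v k * partialDeriv k f x := by
  conv_lhs => rw [← (EuclideanSpace.basisFun (Fin n) ℝ).sum_repr v]
  simp [partialDeriv]

variable {g : EuclideanSpace ℝ (Fin n) → Matrix (Fin n) (Fin n) ℝ}
  {S : Set (EuclideanSpace ℝ (Fin n))}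

theorem contDiffOn_partialDeriv (hS : IsOpen S) {f : EuclideanSpace ℝ (Fin n) → ℝ}
    (hf : ContDiffOn ℝ ∞ f S) (i : Fin n) : ContDiffOn ℝ ∞ (partialDeriv i f) S :=
  (hf.fderiv_of_isOpen hS (by simp)).clm_apply contDiffOn_const

theorem contDiffOn_det {m : ℕ} {A : EuclideanSpace ℝ (Fin n) → Matrix (Fin m) (Fin m) ℝ}
    (hA : ∀ i j, ContDiffOn ℝ ∞ (fun x => A x i j) S) :
    ContDiffOn ℝ ∞ (fun x => (A x).det) S := by
  simp only [Matrix.det_apply']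
  exact ContDiffOn.sum fun σ _ => contDiffOn_const.mul (contDiffOn_prod fun i _ => hA _ _)

/-- Cramer's rule: the entries are quotients of determinants, and det g > 0 by positive
definiteness. -/
theorem IsRiemannianMetricOn.contDiffOn_inv (hg : IsRiemannianMetricOn g S) (k l : Fin n) :
    ContDiffOn ℝ ∞ (fun x => (g x)⁻¹ k l) S := by
  simp only [Matrix.inv_def, Ring.inverse_eq_inv', Matrix.smul_apply, smul_eq_mul,
    Matrix.adjugate_apply]
  refine ContDiffOn.mul ((contDiffOn_det hg.1).inv fun x hx => (hg.2 x hx).det_pos.ne')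
    (contDiffOn_det fun i j => ?_)
  by_cases h : i = l
  · subst h
    simpa using contDiffOn_const
  · simpa [Matrix.updateRow_ne h] using hg.1 i j

theorem IsRiemannianMetricOn.contDiffOn_christoffel (hS : IsOpen S)
    (hg : IsRiemannianMetricOn g S) (k i j : Fin n) :
    ContDiffOn ℝ ∞ (fun x => christoffel g x k i j) S := by
  unfold christoffel
  have h := fun i j l => contDiffOn_partialDeriv hS (hg.1 i j) l
  exact contDiffOn_const.mul (ContDiffOn.sum fun l _ =>
    (hg.contDiffOn_inv k l).mul (((h _ _ _).add (h _ _ _)).sub (h _ _ _)))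

theorem IsRiemannianMetricOn.contDiffOn_geodesicField (hS : IsOpen S)
    (hg : IsRiemannianMetricOn g S) :
    ContDiffOn ℝ ∞ (geodesicField g) (S ×ˢ Set.univ) := by
  refine contDiffOn_snd.prodMk ?_
  rw [contDiffOn_euclidean]
  intro k
  refine ContDiffOn.neg (ContDiffOn.sum fun i _ => ContDiffOn.sum fun j _ => ?_)
  have hv : ∀ i : Fin n, ContDiffOn ℝ ∞ (fun z : EuclideanSpace ℝ (Fin n) ×
      EuclideanSpace ℝ (Fin n) => z.2 i) (S ×ˢ Set.univ) := by
    intro i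
    exact (contDiffOn_euclidean.mp contDiffOn_snd) i
  exact (((hg.contDiffOn_christoffel hS k i j).comp contDiffOn_fst fun z hz => hz.1).mul
    (hv i)).mul (hv j)

/-- Lowering the upper index cancels g⁻¹ and leaves the Christoffel symbols of the first kind. -/
theorem IsRiemannianMetricOn.sum_mul_christoffel (hg : IsRiemannianMetricOn g S)
    {x : EuclideanSpace ℝ (Fin n)} (hx : x ∈ S) (m i j : Fin n) :
    ∑ k, g x m k * christoffel g x k i j = (1 / 2 : ℝ) *
      (partialDeriv i (fun y => g y j m) x + partialDeriv j (fun y => g y i m) x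
        - partialDeriv m (fun y => g y i j) x) := by
  have hinv : g x * (g x)⁻¹ = 1 :=
    Matrix.mul_nonsing_inv _ (hg.2 x hx).det_pos.ne'.isUnit
  have hent : ∀ l, ∑ k, g x m k * (g x)⁻¹ k l = if m = l then 1 else 0 := fun l => by
    rw [← Matrix.mul_apply, hinv, Matrix.one_apply]
  simp only [christoffel, mul_left_comm _ (1 / 2 : ℝ), ← Finset.mul_sum]
  congr 1
  simp only [Finset.mul_sum, ← mul_assoc]
  rw [Finset.sum_comm]
  simp only [← Finset.sum_mul, hent, ite_mul, one_mul, zero_mul, Finset.sum_ite_eq,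
    Finset.mem_univ, if_true]

/-- The acceleration of a geodesic compensates the variation of the metric. -/
theorem IsRiemannianMetricOn.sum_acceleration (hg : IsRiemannianMetricOn g S)
    {x : EuclideanSpace ℝ (Fin n)} (hx : x ∈ S) (v : EuclideanSpace ℝ (Fin n)) :
    2 * ∑ i, ∑ j, g x i j * v i * (geodesicField g (x, v)).2 j =
      -∑ i, ∑ j, (∑ k, v k * partialDeriv k (fun y => g y i j) x) * v i * v j := by
  set D : Fin n → Fin n → Fin n → ℝ := fun k i j => partialDeriv k (fun y => g y i j) x with hD
  have hΓ : ∀ m i j, ∑ k, g x m k * christoffel g x k i j =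
      (1 / 2 : ℝ) * (D i j m + D j i m - D m i j) := fun m i j => hg.sum_mul_christoffel hx m i j
  have step : ∀ m, ∑ j, g x m j * v m * (geodesicField g (x, v)).2 j =
      -∑ i, ∑ j, (1 / 2 : ℝ) * (D i j m + D j i m - D m i j) * v i * v j * v m := by
    intro m
    simp only [geodesicField, ← hΓ, mul_neg, Finset.sum_neg_distrib, neg_inj, Finset.mul_sum,
      Finset.sum_mul]
    rw [Finset.sum_comm]
    refine Finset.sum_congr rfl fun i _ => ?_
    rw [Finset.sum_comm]
    refine Finset.sum_congr rfl fun j _ => Finset.sum_congr rfl fun k _ => ?_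
    ring
  -- Contracted with v three times, the three derivative terms become equal after renaming indices;
  -- the signs +, +, - leave one of them.
  have e1 : ∑ m, ∑ i, ∑ j, D i j m * v i * v j * v m =
      ∑ i, ∑ j, ∑ k, D k i j * v k * v i * v j := by
    rw [Finset.sum_comm (γ := Fin n)]
    rw [Finset.sum_congr rfl fun k _ => Finset.sum_comm, Finset.sum_comm]
    exact Finset.sum_congr rfl fun i _ => Finset.sum_comm
  have e2 : ∑ m, ∑ i, ∑ j, D j i m * v i * v j * v m =
      ∑ i, ∑ j, ∑ k, D k i j * v k * v i * v j := by
    rw [Finset.sum_comm]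
    simp only [mul_right_comm _ (v _) (v _)]
  have e3 : ∑ m, ∑ i, ∑ j, D m i j * v i * v j * v m =
      ∑ i, ∑ j, ∑ k, D k i j * v k * v i * v j := by
    rw [Finset.sum_comm]
    refine Finset.sum_congr rfl fun i _ => ?_
    rw [Finset.sum_comm]
    exact Finset.sum_congr rfl fun j _ => Finset.sum_congr rfl fun k _ => by ring
  have e0 : ∑ i, ∑ j, (∑ k, v k * D k i j) * v i * v j =
      ∑ i, ∑ j, ∑ k, D k i j * v k * v i * v j := by
    simp only [Finset.sum_mul]
    exact Finset.sum_congr rfl fun i _ => Finset.sum_congr rfl fun j _ =>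
      Finset.sum_congr rfl fun k _ => by ring
  have e : ∑ m, ∑ i, ∑ j, (1 / 2 : ℝ) * (D i j m + D j i m - D m i j) * v i * v j * v m =
      (1 / 2 : ℝ) * (∑ m, ∑ i, ∑ j, D i j m * v i * v j * v m +
        ∑ m, ∑ i, ∑ j, D j i m * v i * v j * v m - ∑ m, ∑ i, ∑ j, D m i j * v i * v j * v m) := by
    simp only [← Finset.sum_add_distrib, ← Finset.sum_sub_distrib, Finset.mul_sum]
    exact Finset.sum_congr rfl fun i _ => Finset.sum_congr rfl fun j _ =>
      Finset.sum_congr rfl fun k _ => by ring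
  simp only [step, Finset.sum_neg_distrib]
  rw [e, e1, e2, e3, e0]
  ring

/-- By symmetry of g the two acceleration terms of the product rule coincide, and `sum_acceleration`
cancels them against the derivative of g. The factor c is the value of the cut-off; it scales every
term alike. -/
theorem IsRiemannianMetricOn.hasDerivAt_metricEnergy (hS : IsOpen S)
    (hg : IsRiemannianMetricOn g S)
    {z : ℝ → EuclideanSpace ℝ (Fin n) × EuclideanSpace ℝ (Fin n)} {c t : ℝ}
    (hzS : (z t).1 ∈ S) (hz : HasDerivAt z (c • geodesicField g (z t)) t) :
    HasDerivAt (fun s => metricEnergy g (z s)) 0 t := by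
  have h1 : HasDerivAt (fun s => (z s).1) (c • (z t).2) t := hz.fst
  have h2 : HasDerivAt (fun s => (z s).2) (c • (geodesicField g (z t)).2) t := hz.snd
  have hv : ∀ i, HasDerivAt (fun s => (z s).2 i) (c * (geodesicField g (z t)).2 i) t := fun i => by
    simpa using hasDerivAt_pi.mp
      ((EuclideanSpace.equiv (Fin n) ℝ).toContinuousLinearMap.hasFDerivAt.comp_hasDerivAt t h2) i
  have hgij : ∀ i j, HasDerivAt (fun s => g (z s).1 i j)
      (c * ∑ k, (z t).2 k * partialDeriv k (fun y => g y i j) (z t).1) t := by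
    intro i j
    have hd : DifferentiableAt ℝ (fun y => g y i j) (z t).1 :=
      ((hg.1 i j).contDiffAt (hS.mem_nhds hzS)).differentiableAt (by simp)
    have := hd.hasFDerivAt.comp_hasDerivAt t h1
    rw [map_smul, fderiv_apply_eq_sum_partialDeriv] at this
    exact this
  have hsymm : ∀ i j, g (z t).1 i j = g (z t).1 j i := fun i j => by
    simpa using ((hg.2 _ hzS).isHermitian.apply i j).symm
  have hacc := hg.sum_acceleration hzS (z t).2
  have := HasDerivAt.fun_sum (u := Finset.univ) fun i _ => HasDerivAt.fun_sum (u := Finset.univ)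
    fun j _ => ((hgij i j).mul (hv i)).mul (hv j)
  refine this.congr_deriv ?_
  have hswap : ∑ i, ∑ j, g (z t).1 i j * (geodesicField g (z t)).2 i * (z t).2 j =
      ∑ i, ∑ j, g (z t).1 i j * (z t).2 i * (geodesicField g (z t)).2 j := by
    rw [Finset.sum_comm]
    exact Finset.sum_congr rfl fun i _ => Finset.sum_congr rfl fun j _ => by
      rw [hsymm j i]; ring
  trans c * (∑ i, ∑ j, (∑ k, (z t).2 k * partialDeriv k (fun y => g y i j) (z t).1) * (z t).2 i
      * (z t).2 j + ∑ i, ∑ j, g (z t).1 i j * (geodesicField g (z t)).2 i * (z t).2 j +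
      ∑ i, ∑ j, g (z t).1 i j * (z t).2 i * (geodesicField g (z t)).2 j)
  · simp only [← Finset.sum_add_distrib, Pi.mul_apply]
    rw [Finset.mul_sum]
    refine Finset.sum_congr rfl fun i _ => ?_
    rw [Finset.mul_sum]
    exact Finset.sum_congr rfl fun j _ => by ring
  · rw [hswap]
    linear_combination c * hacc

/-- A Riemannian metric on an open set which dominates the Euclidean metric is geodesically
complete if there is a proper function whose gradient is bounded with respect to it. -/
theorem IsRiemannianMetricOn.isGeodesicallyComplete (hS : IsOpen S)
    (hg : IsRiemannianMetricOn g S)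
    (hdom : ∀ x ∈ S, ∀ v, ‖v‖ ^ 2 ≤ metricEnergy g (x, v))
    {f : EuclideanSpace ℝ (Fin n) → ℝ} {C : ℝ} (hC : 0 ≤ C)
    (hf : ∀ x ∈ S, DifferentiableAt ℝ f x)
    (hgrad : ∀ x ∈ S, ∀ v, |fderiv ℝ f x v| ≤ C * √(metricEnergy g (x, v)))
    (hproper : ∀ R, ∃ K ⊆ S, IsCompact K ∧ ∀ x ∈ S, |f x| ≤ R → x ∈ K) :
    IsGeodesicallyComplete g S := by
  intro p hp v
  have hX := hg.contDiffOn_geodesicField hS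
  have hΩ : IsOpen (S ×ˢ (Set.univ : Set (EuclideanSpace ℝ (Fin n)))) := hS.prod isOpen_univ
  obtain ⟨z, hz0, hz⟩ := exists_global_integralCurve hΩ
    (hX.of_le (by exact_mod_cast le_top)) (z₀ := (p, v)) ⟨hp, trivial⟩ (by
      intro T hT
      set e := √(metricEnergy g (p, v)) with he
      -- Along the curve f changes at rate at most C e, hence by at most C e T.
      obtain ⟨K, hKS, hK, hfK⟩ := hproper (|f p| + C * e * T)
      refine ⟨K ×ˢ Metric.closedBall 0 e, Set.prod_mono hKS (Set.subset_univ _),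
        hK.prod (isCompact_closedBall _ _), fun χ hχ z hz0 hz => ?_⟩
      have h0 : (0 : ℝ) ∈ Set.Ioo (-T) T := ⟨by linarith, hT⟩
      have henergy : ∀ t ∈ Set.Ioo (-T) T, metricEnergy g (z t) = metricEnergy g (p, v) := by
        intro t ht
        have := (convex_Ioo (-T) T).norm_image_sub_le_of_norm_hasDerivWithin_le (C := 0)
          (fun s hs => (hg.hasDerivAt_metricEnergy hS (hz s hs).1.1 (hz s hs).2).hasDerivWithinAt)
          (by simp) h0 ht
        rw [hz0, zero_mul, norm_le_zero_iff, sub_eq_zero] at this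
        exact this
      intro t ht
      refine ⟨hfK _ (hz t ht).1.1 ?_, ?_⟩
      · have hder : ∀ s ∈ Set.Ioo (-T) T, HasDerivWithinAt (fun s => f (z s).1)
            (χ (z s) * fderiv ℝ f (z s).1 (z s).2) (Set.Ioo (-T) T) s := by
          intro s hs
          have h1 : HasDerivAt (fun s => (z s).1) (χ (z s) • (z s).2) s := (hz s hs).2.fst
          have := (hf _ (hz s hs).1.1).hasFDerivAt.comp_hasDerivAt s h1
          rw [map_smul] at this
          exact this.hasDerivWithinAt
        have hbound : ∀ s ∈ Set.Ioo (-T) T,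
            ‖χ (z s) * fderiv ℝ f (z s).1 (z s).2‖ ≤ C * e := by
          intro s hs
          have h2 := hgrad _ (hz s hs).1.1 (z s).2
          rw [Prod.mk.eta, henergy s hs] at h2
          rw [norm_mul, Real.norm_of_nonneg (hχ _).1, Real.norm_eq_abs]
          exact (mul_le_of_le_one_left (abs_nonneg _) (hχ _).2).trans h2
        have := (convex_Ioo (-T) T).norm_image_sub_le_of_norm_hasDerivWithin_le hder hbound h0 ht
        rw [hz0, sub_zero, Real.norm_eq_abs, Real.norm_eq_abs] at this
        have h3 : C * e * |t| ≤ C * e * T :=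
          mul_le_mul_of_nonneg_left (abs_lt.mpr ht).le (mul_nonneg hC (Real.sqrt_nonneg _))
        have h4 := abs_sub_abs_le_abs_sub (f (z t).1) (f p)
        linarith
      · rw [mem_closedBall_zero_iff]
        refine Real.le_sqrt_of_sq_le ?_
        rw [← henergy t ht]
        exact hdom _ (hz t ht).1.1 _)
  have hzc : ContDiff ℝ ∞ z := contDiff_of_integralCurve hX hz
  have hd1 : deriv (fun t => (z t).1) = fun t => (z t).2 :=
    funext fun t => HasDerivAt.deriv (f' := (z t).2) (hz t).2.fst
  have hd2 : ∀ t, deriv (fun t => (z t).2) t = (geodesicField g (z t)).2 :=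
    fun t => HasDerivAt.deriv (f' := (geodesicField g (z t)).2) (hz t).2.snd
  refine ⟨fun t => (z t).1, ⟨contDiff_fst.comp hzc, fun t => (hz t).1.1, fun t k => ?_⟩, ?_, ?_⟩
  · rw [hd1, hd2]
    simp [geodesicField]
  · simp [hz0]
  · simp [hd1, hz0]

end Geodesics

/-! ### Kerr estimates, smoothness and completeness. -/

section Kerr

variable {M a : ℝ}

theorem le_kerrHorizon : M ≤ kerrHorizon M a := le_add_of_nonneg_right (Real.sqrt_nonneg _)

theorem kerrHorizon_le (hM : 0 < M) : kerrHorizon M a ≤ 2 * M := by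
  have : √(M ^ 2 - a ^ 2) ≤ M := Real.sqrt_le_iff.mpr ⟨hM.le, by linarith [sq_nonneg a]⟩
  unfold kerrHorizon
  linarith

/-- The roots of Δ sum to 2M, so the inner one is 2M - r₁. -/
theorem kerrDelta_eq (ha : a ^ 2 ≤ M ^ 2) (r : ℝ) :
    kerrDelta M a r = (r - kerrHorizon M a) * (r - (2 * M - kerrHorizon M a)) := by
  have := Real.sq_sqrt (sub_nonneg.mpr ha)
  unfold kerrDelta kerrHorizon
  linear_combination this

theorem kerrDelta_pos (ha : a ^ 2 ≤ M ^ 2) {r : ℝ} (hr : kerrHorizon M a < r) :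
    0 < kerrDelta M a r := by
  rw [kerrDelta_eq ha]
  have := le_kerrHorizon (M := M) (a := a)
  exact mul_pos (by linarith) (by linarith)

/-- The inner root is nonnegative and can be dropped. The factor r - r₁ that remains is what puts
the horizon at infinite distance, also in the extremal case. -/
theorem kerrDelta_le (hM : 0 < M) (ha : a ^ 2 ≤ M ^ 2) {r : ℝ} (hr : kerrHorizon M a < r) :
    kerrDelta M a r ≤ (r - kerrHorizon M a) * r := by
  rw [kerrDelta_eq ha]
  have := kerrHorizon_le (a := a) hM
  exact mul_le_mul_of_nonneg_left (by linarith) (by linarith)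

theorem pow_four_le_kerrSigmaSq (hM : 0 < M) {r : ℝ} (hr : 0 < r) (ϑ : ℝ) :
    r ^ 4 ≤ kerrSigmaSq M a r ϑ := by
  have : kerrSigmaSq M a r ϑ = r ^ 4 + (r ^ 2 * a ^ 2 * Real.cos ϑ ^ 2 + a ^ 2 * r ^ 2
      + a ^ 2 * a ^ 2 * Real.cos ϑ ^ 2 + 2 * M * r * a ^ 2 * Real.sin ϑ ^ 2) := by
    unfold kerrSigmaSq kerrU
    ring
  rw [this]
  exact le_add_of_nonneg_right (by positivity)

/-- Eliminates the arccos, which is not differentiable on the axis. -/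
theorem kerrSigmaSq_eq_of_cos (r ϑ c : ℝ) (h : Real.cos ϑ = c) :
    kerrSigmaSq M a r ϑ =
      (r ^ 2 + a ^ 2) * (r ^ 2 + a ^ 2 * c ^ 2) + 2 * M * r * a ^ 2 * (1 - c ^ 2) := by
  rw [kerrSigmaSq, kerrU, Real.sin_sq, h]

theorem cos_arccos_apply_div_norm (x : EuclideanSpace ℝ (Fin 3)) :
    Real.cos (Real.arccos (x 2 / ‖x‖)) = x 2 / ‖x‖ := by
  have h : |x 2 / ‖x‖| ≤ 1 := by
    rw [abs_div, abs_norm]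
    exact div_le_one_of_le₀ (PiLp.norm_apply_le x 2) (norm_nonneg _)
  exact Real.cos_arccos (abs_le.mp h).1 (abs_le.mp h).2

theorem isOpen_kerrExterior : IsOpen (kerrExterior M a) :=
  isOpen_lt continuous_const continuous_norm

theorem norm_pos_of_mem_kerrExterior (hM : 0 < M) {x : EuclideanSpace ℝ (Fin 3)}
    (hx : x ∈ kerrExterior M a) : 0 < ‖x‖ :=
  (hM.trans_le le_kerrHorizon).trans hx

theorem inner_fin_three (y z : EuclideanSpace ℝ (Fin 3)) :
    inner ℝ y z = y 0 * z 0 + y 1 * z 1 + y 2 * z 2 := by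
  simp [PiLp.inner_apply, Fin.sum_univ_three, mul_comm]

/-- Coordinate-free form of ĝ, serving both the energy estimates and the pull-back. -/
theorem sum_mul_kerrHatMetric (x u w : EuclideanSpace ℝ (Fin 3)) :
    ∑ k, ∑ l, u k * w l * kerrHatMetric M a x k l =
      kerrSigmaSq M a ‖x‖ (Real.arccos (x 2 / ‖x‖)) / kerrDelta M a ‖x‖ ^ 2
          * (inner ℝ x u * inner ℝ x w / ‖x‖ ^ 2)
        + kerrSigmaSq M a ‖x‖ (Real.arccos (x 2 / ‖x‖)) / kerrDelta M a ‖x‖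
          * ((inner ℝ u w - inner ℝ x u * inner ℝ x w / ‖x‖ ^ 2) / ‖x‖ ^ 2) := by
  simp only [inner_fin_three, kerrHatMetric, Matrix.of_apply, Fin.sum_univ_three]
  simp
  ring

theorem metricEnergy_kerrHatMetric (x v : EuclideanSpace ℝ (Fin 3)) :
    metricEnergy (kerrHatMetric M a) (x, v) =
      kerrSigmaSq M a ‖x‖ (Real.arccos (x 2 / ‖x‖)) / kerrDelta M a ‖x‖ ^ 2
          * (inner ℝ x v / ‖x‖) ^ 2
        + kerrSigmaSq M a ‖x‖ (Real.arccos (x 2 / ‖x‖)) / kerrDelta M a ‖x‖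
          * ((‖v‖ ^ 2 - (inner ℝ x v / ‖x‖) ^ 2) / ‖x‖ ^ 2) := by
  rw [div_pow, sq (inner ℝ x v), ← real_inner_self_eq_norm_sq v, ← sum_mul_kerrHatMetric]
  exact Finset.sum_congr rfl fun i _ => Finset.sum_congr rfl fun j _ => by ring

theorem inner_div_norm_sq_le (x v : EuclideanSpace ℝ (Fin 3)) :
    (inner ℝ x v / ‖x‖) ^ 2 ≤ ‖v‖ ^ 2 := by
  rw [← sq_abs, abs_div, abs_norm]
  exact pow_le_pow_left₀ (by positivity)
    (div_le_of_le_mul₀ (norm_nonneg _) (norm_nonneg _)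
      ((abs_real_inner_le_norm x v).trans_eq (mul_comm _ _))) 2

theorem kerrDelta_le_sq (hM : 0 < M) (ha : a ^ 2 ≤ M ^ 2) {r : ℝ} (hr : kerrHorizon M a < r) :
    kerrDelta M a r ≤ r ^ 2 := by
  have h1 : 0 < kerrHorizon M a := hM.trans_le le_kerrHorizon
  nlinarith [kerrDelta_le hM ha hr, mul_pos h1 (h1.trans hr)]

theorem norm_sq_le_metricEnergy_kerrHatMetric (hM : 0 < M) (ha : a ^ 2 ≤ M ^ 2)
    {x : EuclideanSpace ℝ (Fin 3)} (hx : x ∈ kerrExterior M a) (v : EuclideanSpace ℝ (Fin 3)) :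
    ‖v‖ ^ 2 ≤ metricEnergy (kerrHatMetric M a) (x, v) := by
  have hr := norm_pos_of_mem_kerrExterior hM hx
  have hΔ := kerrDelta_pos ha hx
  have hΔr := kerrDelta_le_sq hM ha hx
  have hσ := pow_four_le_kerrSigmaSq (a := a) hM hr (Real.arccos (x 2 / ‖x‖))
  have hw := inner_div_norm_sq_le x v
  rw [metricEnergy_kerrHatMetric]
  set σ := kerrSigmaSq M a ‖x‖ (Real.arccos (x 2 / ‖x‖))
  set w := (inner ℝ x v / ‖x‖) ^ 2
  have h1 : 1 ≤ σ / kerrDelta M a ‖x‖ ^ 2 := by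
    rw [one_le_div (by positivity)]
    nlinarith
  have h2 : 1 ≤ σ / kerrDelta M a ‖x‖ / ‖x‖ ^ 2 := by
    rw [div_div, one_le_div (by positivity)]
    nlinarith [mul_le_mul_of_nonneg_right hΔr (sq_nonneg ‖x‖)]
  have h3 : 0 ≤ w := sq_nonneg _
  rw [mul_div_assoc', mul_div_right_comm]
  nlinarith

/-- Only the radial part of the energy is kept: the angular part is nonnegative by Cauchy–Schwarz,
and σ² ≥ r⁴. -/
theorem abs_inner_div_norm_le (hM : 0 < M) (ha : a ^ 2 ≤ M ^ 2)
    {x : EuclideanSpace ℝ (Fin 3)} (hx : x ∈ kerrExterior M a) (v : EuclideanSpace ℝ (Fin 3)) :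
    |inner ℝ x v / ‖x‖| ≤
      kerrDelta M a ‖x‖ / ‖x‖ ^ 2 * √(metricEnergy (kerrHatMetric M a) (x, v)) := by
  have hr := norm_pos_of_mem_kerrExterior hM hx
  have hΔ := kerrDelta_pos ha hx
  have hσ := pow_four_le_kerrSigmaSq (a := a) hM hr (Real.arccos (x 2 / ‖x‖))
  have hw := inner_div_norm_sq_le x v
  have hσ0 : 0 ≤ kerrSigmaSq M a ‖x‖ (Real.arccos (x 2 / ‖x‖)) := le_trans (by positivity) hσ
  have hle : (‖x‖ ^ 2 / kerrDelta M a ‖x‖ * |inner ℝ x v / ‖x‖|) ^ 2 ≤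
      metricEnergy (kerrHatMetric M a) (x, v) := by
    rw [metricEnergy_kerrHatMetric, mul_pow, div_pow, sq_abs, ← pow_mul]
    refine le_add_of_le_of_nonneg ?_ ?_
    · gcongr
    · exact mul_nonneg (by positivity) (div_nonneg (sub_nonneg.mpr hw) (by positivity))
  have := Real.le_sqrt_of_sq_le hle
  calc |inner ℝ x v / ‖x‖| = kerrDelta M a ‖x‖ / ‖x‖ ^ 2 *
        (‖x‖ ^ 2 / kerrDelta M a ‖x‖ * |inner ℝ x v / ‖x‖|) := by field_simp
    _ ≤ _ := by gcongr

theorem isRiemannianMetricOn_kerrHatMetric (hM : 0 < M) (ha : a ^ 2 ≤ M ^ 2) :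
    IsRiemannianMetricOn (kerrHatMetric M a) (kerrExterior M a) := by
  refine ⟨fun i j => ?_, fun x hx => ?_⟩
  · have hn : ContDiffOn ℝ ∞ (fun x : EuclideanSpace ℝ (Fin 3) => ‖x‖) (kerrExterior M a) :=
      contDiffOn_id.norm ℝ fun x hx => norm_pos_iff.mp (norm_pos_of_mem_kerrExterior hM hx)
    have hc : ∀ i, ContDiffOn ℝ ∞ (fun x : EuclideanSpace ℝ (Fin 3) => x i)
        (kerrExterior M a) := fun i => (contDiffOn_euclidean.mp contDiffOn_id) i
    have hn0 : ∀ x ∈ kerrExterior M a, ‖x‖ ≠ 0 :=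
      fun x hx => (norm_pos_of_mem_kerrExterior hM hx).ne'
    have hn2 : ∀ x ∈ kerrExterior M a, ‖x‖ ^ 2 ≠ 0 := fun x hx => pow_ne_zero 2 (hn0 x hx)
    have hΔ : ContDiffOn ℝ ∞ (fun x : EuclideanSpace ℝ (Fin 3) => kerrDelta M a ‖x‖)
        (kerrExterior M a) :=
      ((hn.pow 2).sub (contDiffOn_const.mul hn)).add contDiffOn_const
    have hΔ0 : ∀ x ∈ kerrExterior M a, kerrDelta M a ‖x‖ ≠ 0 :=
      fun x hx => (kerrDelta_pos ha hx).ne'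
    have hσ : ContDiffOn ℝ ∞ (fun x : EuclideanSpace ℝ (Fin 3) =>
        kerrSigmaSq M a ‖x‖ (Real.arccos (x 2 / ‖x‖))) (kerrExterior M a) := by
      simp only [kerrSigmaSq_eq_of_cos _ _ _ (cos_arccos_apply_div_norm _)]
      have hd := ((hc 2).div hn hn0).pow 2
      exact (((hn.pow 2).add contDiffOn_const).mul ((hn.pow 2).add (contDiffOn_const.mul hd))).add
        (((contDiffOn_const.mul hn).mul contDiffOn_const).mul (contDiffOn_const.sub hd))
    have hP := ((hc i).mul (hc j)).div (hn.pow 2) hn2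
    exact ((hσ.div (hΔ.pow 2) fun x hx => pow_ne_zero 2 (hΔ0 x hx)).mul hP).add
      ((hσ.div hΔ hΔ0).mul ((contDiffOn_const.sub hP).div (hn.pow 2) hn2))
  · refine Matrix.PosDef.of_dotProduct_mulVec_pos ?_ fun v hv => ?_
    · ext i j
      simp [kerrHatMetric, mul_comm (x i), eq_comm (a := i)]
    · have h := norm_sq_le_metricEnergy_kerrHatMetric hM ha hx (WithLp.toLp 2 v)
      have hv' : 0 < ‖WithLp.toLp 2 v‖ ^ 2 := by
        have : WithLp.toLp 2 v ≠ 0 := by simpa using hv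
        positivity
      refine (hv'.trans_le h).trans_eq ?_
      simp only [metricEnergy, dotProduct, Matrix.mulVec, Finset.mul_sum, star_trivial]
      exact Finset.sum_congr rfl fun i _ => Finset.sum_congr rfl fun j _ => by ring

theorem isGeodesicallyComplete_kerrHatMetric (hM : 0 < M) (ha : a ^ 2 ≤ M ^ 2) :
    IsGeodesicallyComplete (kerrHatMetric M a) (kerrExterior M a) := by
  have hH : 0 < kerrHorizon M a := hM.trans_le le_kerrHorizon
  have hder : ∀ x ∈ kerrExterior M a, HasFDerivAt
      (fun x : EuclideanSpace ℝ (Fin 3) => Real.log (‖x‖ - kerrHorizon M a))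
      ((‖x‖ - kerrHorizon M a)⁻¹ • (‖x‖⁻¹ • innerSL ℝ x)) x := by
    intro x hx
    have h0 : x ≠ 0 := norm_pos_iff.mp (norm_pos_of_mem_kerrExterior hM hx)
    have h1 : HasFDerivAt (fun x : EuclideanSpace ℝ (Fin 3) => ‖x‖) (‖x‖⁻¹ • innerSL ℝ x) x := by
      have := (hasStrictFDerivAt_norm_sq x).hasFDerivAt.sqrt (by positivity)
      simp only [Real.sqrt_sq (norm_nonneg _)] at this
      refine this.congr_fderiv ?_
      ext v
      simp
      ring
    exact (h1.sub_const _).log (sub_pos.mpr hx).ne'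
  refine (isRiemannianMetricOn_kerrHatMetric hM ha).isGeodesicallyComplete isOpen_kerrExterior
    (fun x hx => norm_sq_le_metricEnergy_kerrHatMetric hM ha hx)
    (f := fun x => Real.log (‖x‖ - kerrHorizon M a)) (C := (kerrHorizon M a)⁻¹)
    (by positivity) (fun x hx => (hder x hx).differentiableAt) (fun x hx v => ?_) fun R => ?_
  · have hr := norm_pos_of_mem_kerrExterior hM hx
    have hs : 0 < ‖x‖ - kerrHorizon M a := sub_pos.mpr hx
    have hle := abs_inner_div_norm_le hM ha hx v
    -- The factor r - r₁ cancels the derivative of the logarithm, and r ≥ r₁ leaves the constant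
    -- 1/r₁.
    have hΔ : kerrDelta M a ‖x‖ / ‖x‖ ^ 2 ≤
        (‖x‖ - kerrHorizon M a) * (kerrHorizon M a)⁻¹ := by
      calc kerrDelta M a ‖x‖ / ‖x‖ ^ 2
          ≤ (‖x‖ - kerrHorizon M a) * ‖x‖ / ‖x‖ ^ 2 := by
            gcongr
            exact kerrDelta_le hM ha hx
        _ = (‖x‖ - kerrHorizon M a) * ‖x‖⁻¹ := by field_simp
        _ ≤ _ := by
            have : kerrHorizon M a ≤ ‖x‖ := le_of_lt hx
            gcongr
    rw [(hder x hx).fderiv]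
    simp only [_root_.smul_apply, innerSL_apply_apply, smul_eq_mul]
    rw [abs_mul, abs_of_pos (inv_pos.mpr hs), inv_mul_le_iff₀ hs, mul_comm ‖x‖⁻¹, ← div_eq_mul_inv,
      ← mul_assoc]
    exact hle.trans (mul_le_mul_of_nonneg_right hΔ (Real.sqrt_nonneg _))
  -- |log(r - r₁)| ≤ R means exp(-R) ≤ r - r₁ ≤ exp R.
  · refine ⟨{x | kerrHorizon M a + Real.exp (-R) ≤ ‖x‖ ∧ ‖x‖ ≤ kerrHorizon M a + Real.exp R},
      fun x hx => ?_, ?_, fun x hx hR => ?_⟩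
    · exact (lt_add_of_pos_right _ (Real.exp_pos _)).trans_le hx.1
    · refine Metric.isCompact_of_isClosed_isBounded ?_ ?_
      · exact (isClosed_le continuous_const continuous_norm).inter
          (isClosed_le continuous_norm continuous_const)
      · exact (Metric.isBounded_closedBall (x := 0)
          (r := kerrHorizon M a + Real.exp R)).subset fun x hx => by simpa using hx.2
    · have hs : 0 < ‖x‖ - kerrHorizon M a := sub_pos.mpr hx
      have h1 := (Real.le_log_iff_exp_le hs).mp (abs_le.mp hR).1
      have h2 := (Real.log_le_iff_le_exp hs).mp (abs_le.mp hR).2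
      exact ⟨by linarith, by linarith⟩

/-! ### The metric in polar coordinates. -/

theorem norm_polarMap {q : EuclideanSpace ℝ (Fin 3)} (hq : 0 ≤ q 0) : ‖polarMap q‖ = q 0 := by
  rw [EuclideanSpace.norm_eq, Real.sqrt_eq_iff_mul_self_eq (by positivity) hq]
  simp [polarMap, Fin.sum_univ_three]
  linear_combination ((q 0) ^ 2 * Real.sin (q 1) ^ 2) * Real.sin_sq_add_cos_sq (q 2)
    + (q 0) ^ 2 * Real.sin_sq_add_cos_sq (q 1)

/-- The coordinate vector fields of the polar coordinates. -/
noncomputable def polarFrame (q : EuclideanSpace ℝ (Fin 3)) : Fin 3 → EuclideanSpace ℝ (Fin 3) :=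
  ![!₂[Real.sin (q 1) * Real.cos (q 2), Real.sin (q 1) * Real.sin (q 2), Real.cos (q 1)],
    !₂[q 0 * (Real.cos (q 1) * Real.cos (q 2)), q 0 * (Real.cos (q 1) * Real.sin (q 2)),
      -(q 0 * Real.sin (q 1))],
    !₂[-(q 0 * (Real.sin (q 1) * Real.sin (q 2))), q 0 * (Real.sin (q 1) * Real.cos (q 2)), 0]]

theorem partialDeriv_polarMap (q : EuclideanSpace ℝ (Fin 3)) (i k : Fin 3) :
    partialDeriv i (fun y => polarMap y k) q = polarFrame q i k := by
  have hp : ∀ m : Fin 3, HasFDerivAt (fun y : EuclideanSpace ℝ (Fin 3) => y m)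
      (EuclideanSpace.proj m : EuclideanSpace ℝ (Fin 3) →L[ℝ] ℝ) q :=
    fun m => (EuclideanSpace.proj m : EuclideanSpace ℝ (Fin 3) →L[ℝ] ℝ).hasFDerivAt
  unfold partialDeriv
  fin_cases k
  · change fderiv ℝ (fun y => polarMap y 0) q _ = polarFrame q i 0
    rw [HasFDerivAt.fderiv (f := fun y => polarMap y 0)
      ((hp 0).fun_mul ((hp 1).sin.fun_mul (hp 2).cos))]
    fin_cases i <;> simp [polarFrame, mul_comm]
  · change fderiv ℝ (fun y => polarMap y 1) q _ = polarFrame q i 1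
    rw [HasFDerivAt.fderiv (f := fun y => polarMap y 1)
      ((hp 0).fun_mul ((hp 1).sin.fun_mul (hp 2).sin))]
    fin_cases i <;> simp [polarFrame, mul_comm]
  · change fderiv ℝ (fun y => polarMap y 2) q _ = polarFrame q i 2
    rw [HasFDerivAt.fderiv (f := fun y => polarMap y 2) ((hp 0).fun_mul (hp 1).cos)]
    fin_cases i <;> simp [polarFrame]

theorem inner_polarMap_polarFrame (q : EuclideanSpace ℝ (Fin 3)) (i : Fin 3) :
    inner ℝ (polarMap q) (polarFrame q i) = ![q 0, 0, 0] i := by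
  have h1 := Real.sin_sq_add_cos_sq (q 1)
  have h2 := Real.sin_sq_add_cos_sq (q 2)
  rw [inner_fin_three]
  fin_cases i <;> simp [polarFrame, polarMap]
  · linear_combination q 0 * Real.sin (q 1) ^ 2 * h2 + q 0 * h1
  · linear_combination q 0 ^ 2 * Real.sin (q 1) * Real.cos (q 1) * h2
  · ring

theorem inner_polarFrame (q : EuclideanSpace ℝ (Fin 3)) (i j : Fin 3) :
    inner ℝ (polarFrame q i) (polarFrame q j) =
      Matrix.diagonal ![1, q 0 ^ 2, q 0 ^ 2 * Real.sin (q 1) ^ 2] i j := by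
  have h1 := Real.sin_sq_add_cos_sq (q 1)
  have h2 := Real.sin_sq_add_cos_sq (q 2)
  rw [inner_fin_three]
  fin_cases i <;> fin_cases j <;> simp [polarFrame]
  · linear_combination Real.sin (q 1) ^ 2 * h2 + h1
  · linear_combination q 0 * Real.sin (q 1) * Real.cos (q 1) * h2
  · ring
  · linear_combination q 0 * Real.sin (q 1) * Real.cos (q 1) * h2
  · linear_combination q 0 ^ 2 * Real.cos (q 1) ^ 2 * h2 + q 0 ^ 2 * h1
  · ring
  · ring
  · ring
  · linear_combination q 0 ^ 2 * Real.sin (q 1) ^ 2 * h2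

theorem pullbackMetric_polarMap_kerrHatMetric {q : EuclideanSpace ℝ (Fin 3)} (hq : 0 < q 0) :
    pullbackMetric polarMap (kerrHatMetric M a) q =
      Matrix.diagonal
        ![kerrSigmaSq M a (q 0) (q 1) / kerrDelta M a (q 0) ^ 2,
          kerrSigmaSq M a (q 0) (q 1) / kerrDelta M a (q 0),
          kerrSigmaSq M a (q 0) (q 1) / kerrDelta M a (q 0) * Real.sin (q 1) ^ 2] := by
  have hn := norm_polarMap hq.le
  -- The angle q 1 is arbitrary, so the arccos need not return it; only the cosines agree, which
  -- suffices for σ².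
  have hcos : Real.cos (Real.arccos (polarMap q 2 / ‖polarMap q‖)) = Real.cos (q 1) := by
    rw [cos_arccos_apply_div_norm, hn]
    simp [polarMap, hq.ne']
  have hσ : kerrSigmaSq M a (q 0) (Real.arccos (polarMap q 2 / q 0)) =
      kerrSigmaSq M a (q 0) (q 1) := by
    rw [hn] at hcos
    rw [kerrSigmaSq_eq_of_cos _ _ _ hcos, kerrSigmaSq_eq_of_cos _ _ _ rfl]
  ext i j
  simp only [pullbackMetric, Matrix.of_apply, partialDeriv_polarMap]
  rw [sum_mul_kerrHatMetric, hn, hσ, inner_polarMap_polarFrame, inner_polarMap_polarFrame,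
    inner_polarFrame]
  have hq' := hq.ne'
  fin_cases i <;> fin_cases j <;> simp <;> field_simp <;> simp

end Kerr

theorem mainTheorem10 (M a : ℝ) (hM : 0 < M) (ha : a ^ 2 ≤ M ^ 2) :
    IsOpen (kerrExterior M a) ∧
    IsRiemannianMetricOn (kerrHatMetric M a) (kerrExterior M a) ∧
    (∀ q : EuclideanSpace ℝ (Fin 3), kerrHorizon M a < q 0 →
      polarMap q ∈ kerrExterior M a ∧
      pullbackMetric polarMap (kerrHatMetric M a) q =
        Matrix.diagonal
          ![kerrSigmaSq M a (q 0) (q 1) / kerrDelta M a (q 0) ^ 2,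
            kerrSigmaSq M a (q 0) (q 1) / kerrDelta M a (q 0),
            kerrSigmaSq M a (q 0) (q 1) / kerrDelta M a (q 0) * Real.sin (q 1) ^ 2]) ∧
    IsGeodesicallyComplete (kerrHatMetric M a) (kerrExterior M a) := by
  refine ⟨isOpen_kerrExterior, isRiemannianMetricOn_kerrHatMetric hM ha, fun q hq => ?_,
    isGeodesicallyComplete_kerrHatMetric hM ha⟩
  have hq0 : 0 < q 0 := (hM.trans_le le_kerrHorizon).trans hq
  refine ⟨?_, pullbackMetric_polarMap_kerrHatMetric hq0⟩
  rw [kerrExterior, Set.mem_ofPred_eq, norm_polarMap hq0.le]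
  exact hq
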